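/- Graphs are finite and simple. For a graph $H$ and a family $\mathcal F$ of graphs, let $\mathcal N(H,G)$ be the number of copies of $H$ in $G$ (subgraphs of $G$ isomorphic to $H$), call $G$ $\mathcal F$-free if it contains no member of $\mathcal F$ as a (not necessarily induced) subgraph, and let $\mathrm{ex}(n,H,\mathcal F)$ be the maximum of $\mathcal N(H,G)$ over all $n$-vertex $\mathcal F$-free graphs $G$; let $\mathrm{EX}(n,H,\mathcal F)$ be the set of $n$-vertex $\mathcal F$-free graphs $G$ with $\mathcal N(H,G)=\mathrm{ex}(n,H,\mathcal F)$. Let $K_r$ be the complete graph on $r$ vertices, $M_{s+1}$ the matching of $s+1$ independent edges, $I_m$ the edgeless graph on $m$ vertices, and $G\vee H$ the join of $G$ and $H$. For a graph $F$, let $\mathcal D(F)$ be the set of all graphs obtained from $F$ by deleting a (possibly empty) independent set of vertices, and let $D_F(s,r)$ denote any graph in $\mathrm{EX}(s,K_{r-1},\mathcal D(F))$ with the maximum number of copies of $K_r$ among the graphs in $\mathrm{EX}(s,K_{r-1},\mathcal D(F))$. **Theorem.** Let $r\ge 3$ be an integer and let $F$ be a graph with $\chi(F)>r$. There is $s_0=s_0(F,r)$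 such that for every $s\ge s_0$ a graph $D_F(s,r)$ exists and there is $n_0=n_0(F,r,s)\ge s$ such that for all $n\ge n_0$ and every choice of $D_F(s,r)$, $$\mathrm{ex}(n,K_r,\{F,M_{s+1}\})=\mathcal N\bigl(K_r,\,D_F(s,r)\vee I_{n-s}\bigr).$$ -/

import Mathlib

namespace GenTuran

/-- A finite graph, on a vertex set `Fin m`. -/
abbrev FinGraph : Type := Σ m : ℕ, SimpleGraph (Fin m)

/-- All the finite graphs (on vertex sets `Fin m`) that are isomorphic to `G`. A family of finite
graphs is represented by the set of all graphs on vertex sets `Fin m` isomorphic to a member. -/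
def isoClass {V : Type*} (G : SimpleGraph V) : Set FinGraph :=
  {A | Nonempty (A.2 ≃g G)}

/-- `G` is `𝓕`-free: it contains no member of `𝓕` as a (not necessarily induced) subgraph. -/
def FamilyFree {V : Type*} (𝓕 : Set FinGraph) (G : SimpleGraph V) : Prop :=
  ∀ A ∈ 𝓕, A.2.Free G

/-- The generalized Turán number `ex(n, H, 𝓕)`: the maximum number of copies of `H` in an
`𝓕`-free graph on `n` vertices. -/
noncomputable def ex {W : Type*} (n : ℕ) (H : SimpleGraph W) (𝓕 : Set FinGraph) : ℕ :=
  sSup {k : ℕ | ∃ G : SimpleGraph (Fin n), FamilyFree 𝓕 G ∧ k = G.copyCount H}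

/-- `EX(n, H, 𝓕)`: the `𝓕`-free graphs on `n` vertices with exactly `ex(n, H, 𝓕)` copies
of `H`. -/
def EX {W : Type*} (n : ℕ) (H : SimpleGraph W) (𝓕 : Set FinGraph) : Set (SimpleGraph (Fin n)) :=
  {G | FamilyFree 𝓕 G ∧ G.copyCount H = ex n H 𝓕}

/-- The complete graph `K_r` on `r` vertices. -/
def K (r : ℕ) : SimpleGraph (Fin r) := ⊤

/-- The independent set `I_m`: the graph on `m` vertices without edges. -/
def I (m : ℕ) : SimpleGraph (Fin m) := ⊥

/-- The matching `M_m`: `m` pairwise disjoint edges `{(i, false), (i, true)}`. -/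
def M (m : ℕ) : SimpleGraph (Fin m × Bool) where
  Adj x y := x.1 = y.1 ∧ x.2 ≠ y.2
  symm := ⟨fun _ _ h => ⟨h.1.symm, h.2.symm⟩⟩
  loopless := ⟨fun _ h => h.2 rfl⟩

/-- The join `G ∨ H`: the disjoint union of `G` and `H` together with all edges between them. -/
def join {V W : Type*} (G : SimpleGraph V) (H : SimpleGraph W) : SimpleGraph (V ⊕ W) where
  Adj x y :=
    match x, y with
    | Sum.inl v, Sum.inl v' => G.Adj v v'
    | Sum.inr w, Sum.inr w' => H.Adj w w'
    | Sum.inl _, Sum.inr _ => True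
    | Sum.inr _, Sum.inl _ => True
  symm := ⟨by
    rintro (v | w) (v' | w') h
    · exact G.adj_symm h
    · trivial
    · trivial
    · exact H.adj_symm h⟩
  loopless := ⟨by
    rintro (v | w) h
    · exact G.irrefl h
    · exact H.irrefl h⟩

/-- The family `𝓓(F)` of all graphs obtained from `F` by deleting an independent set of `F`. -/
def deletionFamily {V : Type*} (F : SimpleGraph V) : Set FinGraph :=
  {A | ∃ S : Set V, F.IsIndepSet S ∧ A ∈ isoClass (F.induce Sᶜ)}

/-- The family `{F, M_{s+1}}`. -/
def forbiddenPair {V : Type*} (F : SimpleGraph V) (s : ℕ) : Set FinGraph :=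
  isoClass F ∪ isoClass (M (s + 1))

/-- `D` is a choice of the graph `D_F(s, r)`: a member of `EX(s, K_{r-1}, 𝓓(F))` with the maximum
number of copies of `K_r` among the members of `EX(s, K_{r-1}, 𝓓(F))`. -/
def IsDF {V : Type*} (F : SimpleGraph V) (s r : ℕ) (D : SimpleGraph (Fin s)) : Prop :=
  D ∈ EX s (K (r - 1)) (deletionFamily F) ∧
    ∀ D' ∈ EX s (K (r - 1)) (deletionFamily F), D'.copyCount (K r) ≤ D.copyCount (K r)

end GenTuran

/-! Put `k = r - 1` and `e = ex s (K k) (deletionFamily F)`. Let `G` be an `{F, M_{s+1}}`-free graph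
on `n` vertices, and `A` the set of its vertices of degree at least `2s + 2`. Matching `A` greedily
outwards gives `|A| ≤ s`. All but boundedly many vertices `v` have `N(v) ⊆ A`, and `N(v)` is shared
by at least `|V(F)|` vertices. These can host a deleted independent set of `F`, so `G[N(v)]` is
`𝓓(F)`-free (`exists_exceptional_set`). If every such `N(v)` has fewer than `e` copies of `K_k`,
then `G` has at most `n(e - 1) + O(1)` copies of `K_r`, which is too few. Otherwise some `N(v)`
attains `e`. Since `ex m (K k) (deletionFamily F) < e` for `m < s`, this forces `N(v) = A` and `|A|
= s`. Then no edge avoids `A`, so the count is at most that of `D_F(s, r) ∨ I_{n-s}`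
(`card_cliquesIn_le_of_isDF`). The strict inequality for large `s` is
`exists_forall_ex_deletionFamily_lt`: a Turán graph gives order `m^k` copies of `K_k`, so in an
extremal graph some `(k-1)`-clique has many common neighbours, and a new vertex joined to it creates
no forbidden graph. -/

namespace GenTuran

open Finset

/-! ### Counting cliques inside vertex sets. -/

section Cliques

variable {V W : Type*}

open scoped Classical in
/-- The `k`-cliques of `G` with all vertices in `B`. -/
noncomputable def cliquesIn (G : SimpleGraph V) (k : ℕ) (B : Finset V) : Finset (Finset V) :=
  {t ∈ B.powerset | G.IsNClique k t}

lemma mem_cliquesIn {G : SimpleGraph V} {k : ℕ} {B t : Finset V} :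
    t ∈ cliquesIn G k B ↔ t ⊆ B ∧ G.IsNClique k t := by
  simp [cliquesIn]

open scoped Classical in
/-- The neighbourhood of `v` in `G`. -/
noncomputable def nbrs [Fintype V] (G : SimpleGraph V) (v : V) : Finset V :=
  {w | G.Adj v w}

@[simp] lemma mem_nbrs [Fintype V] {G : SimpleGraph V} {v w : V} :
    w ∈ nbrs G v ↔ G.Adj v w := by
  simp [nbrs]

lemma card_cliquesIn_le_of_embedding {G : SimpleGraph V} {H : SimpleGraph W} (f : V ↪ W)
    {B : Finset V} {C : Finset W} (hBC : ∀ v ∈ B, f v ∈ C)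
    (hf : ∀ v ∈ B, ∀ w ∈ B, G.Adj v w → H.Adj (f v) (f w)) (k : ℕ) :
    #(cliquesIn G k B) ≤ #(cliquesIn H k C) := by
  refine card_le_card_of_injOn (fun t => t.map f) ?_ (fun a _ b _ h => map_injective f h)
  intro t ht
  obtain ⟨htB, hc, hcard⟩ := mem_cliquesIn.1 ht |>.imp id (SimpleGraph.isNClique_iff _).1
  refine mem_cliquesIn.2 ⟨?_, (SimpleGraph.isNClique_iff _).2 ⟨?_, by simpa using hcard⟩⟩
  · intro w hw
    obtain ⟨v, hv, rfl⟩ := mem_map.1 hw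
    exact hBC v (htB hv)
  · intro x hx y hy hxy
    obtain ⟨v, hv, rfl⟩ := mem_map.1 (mem_coe.1 hx)
    obtain ⟨w, hw, rfl⟩ := mem_map.1 (mem_coe.1 hy)
    exact hf v (htB hv) w (htB hw) (hc hv hw fun h => hxy (by rw [h]))

lemma card_cliquesIn_mono {G : SimpleGraph V} {B C : Finset V} (h : B ⊆ C) (k : ℕ) :
    #(cliquesIn G k B) ≤ #(cliquesIn G k C) :=
  card_cliquesIn_le_of_embedding (.refl V) (fun _ hv => h hv) (fun _ _ _ _ h => h) k

lemma card_cliquesIn_le_two_pow (G : SimpleGraph V) (k : ℕ) (B : Finset V) :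
    #(cliquesIn G k B) ≤ 2 ^ #B := by
  classical
  exact (card_filter_le _ _).trans_eq (card_powerset B)

lemma card_cliquesIn_induce [Fintype W] {G : SimpleGraph V} {H : SimpleGraph W} {B : Finset V}
    (e : H ≃g G.induce (B : Set V)) (k : ℕ) :
    #(cliquesIn H k univ) = #(cliquesIn G k B) := by
  classical
  refine le_antisymm ?_ ?_
  · refine card_cliquesIn_le_of_embedding
      (e.toEquiv.toEmbedding.trans (Function.Embedding.subtype _)) ?_ ?_ k
    · intro v _
      exact (e v).2
    · intro v _ w _ h
      exact e.map_rel_iff.2 h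
  · by_cases hB : B = ∅
    · subst hB
      have hW : IsEmpty W := by
        refine ⟨fun w => ?_⟩
        have := (e w).2
        simp at this
      refine card_le_card_of_injOn (fun _ => ∅) ?_ ?_
      · intro t ht
        obtain ⟨h1, h2⟩ := mem_cliquesIn.1 ht
        have h3 := subset_empty.1 h1
        subst h3
        refine mem_cliquesIn.2 ⟨by simp, ?_⟩
        rw [SimpleGraph.isNClique_empty] at *
        exact h2
      · intro a ha b hb _
        rw [subset_empty.1 (mem_cliquesIn.1 ha).1, subset_empty.1 (mem_cliquesIn.1 hb).1]
    · refine card_le_card_of_injOn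
        (fun t => univ.filter fun w => (e w : V) ∈ t) ?_ ?_
      · intro t ht
        obtain ⟨h1, h2⟩ := mem_cliquesIn.1 ht
        have hmap : (univ.filter fun w => (e w : V) ∈ t).image (fun w => (e w : V)) = t := by
          ext v
          simp only [mem_image, mem_filter, mem_univ, true_and]
          refine ⟨by rintro ⟨w, hw, rfl⟩; exact hw, fun hv => ?_⟩
          refine ⟨e.symm ⟨v, h1 hv⟩, ?_, ?_⟩ <;> simp [hv]
        have hinj : Function.Injective fun w => (e w : V) :=
          Subtype.val_injective.comp e.injective
        refine mem_cliquesIn.2 ⟨subset_univ _, (SimpleGraph.isNClique_iff _).2 ⟨?_, ?_⟩⟩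
        · intro x hx y hy hxy
          have hx' : (e x : V) ∈ t := by simpa using hx
          have hy' : (e y : V) ∈ t := by simpa using hy
          exact e.map_rel_iff.1 (h2.isClique hx' hy' (hinj.ne hxy))
        · rw [← card_image_of_injective _ hinj, hmap, h2.card_eq]
      · intro a ha b hb hab
        have key : ∀ c ∈ cliquesIn G k B, ∀ v, v ∈ c ↔ ∃ w, (e w : V) ∈ c ∧ (e w : V) = v := by
          intro c hc v
          refine ⟨fun hv => ⟨e.symm ⟨v, (mem_cliquesIn.1 hc).1 hv⟩, ?_⟩, ?_⟩
          · simp [hv]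
          · rintro ⟨w, hw, rfl⟩
            exact hw
        have hw : ∀ w, (e w : V) ∈ a ↔ (e w : V) ∈ b := by
          intro w
          have := congrArg (w ∈ ·) hab
          simpa using this
        ext v
        rw [key a ha, key b hb]
        simp only [hw]

/-- A clique of size `k + 1` is either contained in `B`, or consists of a vertex outside `B` and a
`k`-clique in its neighbourhood. -/
lemma card_cliquesIn_le_add_sum [Fintype V] [DecidableEq V] (G : SimpleGraph V) (k : ℕ)
    (B : Finset V) :
    #(cliquesIn G (k + 1) univ) ≤
      #(cliquesIn G (k + 1) B) + ∑ v ∈ Bᶜ, #(cliquesIn G k (nbrs G v)) := by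
  have hsub : cliquesIn G (k + 1) univ ⊆ cliquesIn G (k + 1) B ∪
      Bᶜ.biUnion fun v => (cliquesIn G k (nbrs G v)).image (insert v) := by
    intro t ht
    obtain ⟨-, ht⟩ := mem_cliquesIn.1 ht
    by_cases h : t ⊆ B
    · exact mem_union_left _ (mem_cliquesIn.2 ⟨h, ht⟩)
    · obtain ⟨v, hv, hvB⟩ := not_subset.1 h
      refine mem_union_right _ (mem_biUnion.2 ⟨v, by simpa using hvB, mem_image.2
        ⟨t.erase v, mem_cliquesIn.2 ⟨?_, by simpa using ht.erase_of_mem hv⟩, insert_erase hv⟩⟩)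
      intro w hw
      rw [mem_erase] at hw
      exact mem_nbrs.2 (ht.isClique hv hw.2 hw.1.symm)
  refine (card_le_card hsub).trans ((card_union_le _ _).trans (Nat.add_le_add_left ?_ _))
  exact card_biUnion_le.trans (sum_le_sum fun v _ => card_image_le)

/-- A copy of a complete graph is determined by its vertex set, so all later counting can be done
with `cliquesIn`. -/
lemma copyCount_K [Fintype V] (G : SimpleGraph V) (k : ℕ) :
    G.copyCount (K k) = #(cliquesIn G k univ) := by
  classical
  rw [SimpleGraph.copyCount]
  refine card_bij' (fun G' _ => G'.verts.toFinset)
    (fun t _ => (⊤ : G.Subgraph).induce t) ?_ ?_ ?_ ?_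
  · intro G' hG'
    obtain ⟨e⟩ := (mem_filter.1 hG').2
    refine mem_cliquesIn.2 ⟨subset_univ _, (SimpleGraph.isNClique_iff _).2 ⟨?_, ?_⟩⟩
    · intro x hx y hy hxy
      have hx' : x ∈ G'.verts := by simpa using hx
      have hy' : y ∈ G'.verts := by simpa using hy
      refine G'.adj_sub (v := x) (w := y) ?_
      have : G'.coe.Adj ⟨x, hx'⟩ ⟨y, hy'⟩ := by
        rw [← e.apply_symm_apply ⟨x, hx'⟩, ← e.apply_symm_apply ⟨y, hy'⟩]
        refine e.map_rel_iff.2 ?_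
        intro h
        exact hxy (congrArg Subtype.val (e.symm.injective h))
      exact this
    · rw [Set.toFinset_card, ← Fintype.card_congr e.toEquiv, Fintype.card_fin]
  · intro t ht
    obtain ⟨-, ht⟩ := mem_cliquesIn.1 ht
    refine mem_filter.2 ⟨mem_univ _, ⟨⟨(t.equivFinOfCardEq ht.card_eq).symm, ?_⟩⟩⟩
    intro a b
    simp only [SimpleGraph.Subgraph.coe_adj, SimpleGraph.Subgraph.induce_adj,
      SimpleGraph.Subgraph.top_adj, K, SimpleGraph.top_adj]
    refine ⟨fun h hab => ?_, fun h => ⟨Subtype.coe_prop _, Subtype.coe_prop _, ?_⟩⟩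
    · subst hab
      exact G.irrefl h.2.2
    · refine ht.isClique (Subtype.coe_prop _) (Subtype.coe_prop _) fun h' => h ?_
      exact (t.equivFinOfCardEq ht.card_eq).symm.injective (Subtype.ext h')
  · intro G' hG'
    obtain ⟨e⟩ := (mem_filter.1 hG').2
    refine SimpleGraph.Subgraph.ext (by simp) ?_
    ext x y
    simp only [Set.coe_toFinset, SimpleGraph.Subgraph.induce_adj, SimpleGraph.Subgraph.top_adj]
    refine ⟨fun ⟨hx, hy, hxy⟩ => ?_, fun h => ⟨h.fst_mem, h.snd_mem, h.adj_sub⟩⟩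
    have : G'.coe.Adj ⟨x, hx⟩ ⟨y, hy⟩ := by
      rw [← e.apply_symm_apply ⟨x, hx⟩, ← e.apply_symm_apply ⟨y, hy⟩]
      refine e.map_rel_iff.2 ?_
      intro h
      exact hxy.ne (congrArg Subtype.val (e.symm.injective h))
    exact this
  · intro t ht
    simp

end Cliques

/-! ### Attainment and transfer of generalized Turán numbers. -/

section Extremal

variable {V W : Type*}

lemma bddAbove_copyCount (n : ℕ) (H : SimpleGraph W) (𝓕 : Set FinGraph) :
    BddAbove {k : ℕ | ∃ G : SimpleGraph (Fin n), FamilyFree 𝓕 G ∧ k = G.copyCount H} := by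
  classical
  refine (Set.Finite.subset (Set.finite_range fun G : SimpleGraph (Fin n) => G.copyCount H)
    ?_).bddAbove
  rintro k ⟨G, -, rfl⟩
  exact ⟨G, rfl⟩

lemma copyCount_le_ex {n : ℕ} (H : SimpleGraph W) {𝓕 : Set FinGraph} {G : SimpleGraph (Fin n)}
    (hG : FamilyFree 𝓕 G) : G.copyCount H ≤ ex n H 𝓕 :=
  le_csSup (bddAbove_copyCount n H 𝓕) ⟨G, hG, rfl⟩

lemma exists_mem_EX {n : ℕ} (H : SimpleGraph W) {𝓕 : Set FinGraph} {G : SimpleGraph (Fin n)}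
    (hG : FamilyFree 𝓕 G) : (EX n H 𝓕).Nonempty := by
  have hne : {k : ℕ | ∃ G : SimpleGraph (Fin n), FamilyFree 𝓕 G ∧ k = G.copyCount H}.Nonempty :=
    ⟨_, G, hG, rfl⟩
  obtain ⟨G', hG', h⟩ := Nat.sSup_mem hne (bddAbove_copyCount n H 𝓕)
  exact ⟨G', hG', h.symm⟩

lemma FamilyFree.of_isContained {𝓕 : Set FinGraph} {G : SimpleGraph V} {H : SimpleGraph W}
    (hG : FamilyFree 𝓕 G) (h : H.IsContained G) : FamilyFree 𝓕 H :=
  fun A hA hAH => hG A hA (hAH.trans h)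

lemma exists_iso_induce (G : SimpleGraph V) {m : ℕ} {B : Finset V} (hB : #B = m) :
    ∃ H : SimpleGraph (Fin m), Nonempty (H ≃g G.induce (B : Set V)) :=
  ⟨_, ⟨SimpleGraph.Iso.comap (B.equivFinOfCardEq hB).symm (G.induce (B : Set V))⟩⟩

lemma card_cliquesIn_le_ex {𝓕 : Set FinGraph} {G : SimpleGraph V} {B : Finset V}
    (h : FamilyFree 𝓕 (G.induce (B : Set V))) (k : ℕ) :
    #(cliquesIn G k B) ≤ ex #B (K k) 𝓕 := by
  obtain ⟨H, ⟨e⟩⟩ := exists_iso_induce G (B := B) rfl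
  rw [← card_cliquesIn_induce e, ← copyCount_K]
  exact copyCount_le_ex _ (h.of_isContained e.isContained)

lemma card_cliquesIn_univ_le_ex [Fintype V] {𝓕 : Set FinGraph} {G : SimpleGraph V}
    (h : FamilyFree 𝓕 G) (k : ℕ) :
    #(cliquesIn G k univ) ≤ ex (Fintype.card V) (K k) 𝓕 :=
  card_cliquesIn_le_ex (h.of_isContained (SimpleGraph.Embedding.induce _).isContained) k

end Extremal


/-! ### Turán graphs as `𝓓(F)`-free graphs with many cliques. -/

section Turan

variable {V W : Type*}

/-- One new colour suffices for the deleted independent set. Hence every member of `𝓓(F)` has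
chromatic number at least `χ(F) - 1`. -/
lemma colorable_succ_of_induce_compl {F : SimpleGraph V} {S : Set V} (hS : F.IsIndepSet S) {k : ℕ}
    (h : (F.induce Sᶜ).Colorable k) : F.Colorable (k + 1) := by
  classical
  obtain ⟨c⟩ := h
  refine ⟨SimpleGraph.Coloring.mk
    (fun v => if hv : v ∈ S then Fin.last k else (c ⟨v, hv⟩).castSucc) ?_⟩
  intro v w hvw
  by_cases hv : v ∈ S <;> by_cases hw : w ∈ S <;> simp only [hv, hw, dite_true, dite_false]
  · exact absurd hvw (hS hv hw hvw.ne)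
  · exact (Fin.castSucc_lt_last _).ne'
  · exact (Fin.castSucc_lt_last _).ne
  · intro h
    exact c.valid (v := ⟨v, hv⟩) (w := ⟨w, hw⟩) hvw (Fin.castSucc_injective _ h)

lemma familyFree_deletionFamily_of_colorable {F : SimpleGraph V} {k : ℕ}
    (hF : ((k + 1 : ℕ) : ℕ∞) < F.chromaticNumber) {G : SimpleGraph W} (hG : G.Colorable k) :
    FamilyFree (deletionFamily F) G := by
  rintro A ⟨S, hS, ⟨e⟩⟩ ⟨f⟩
  have h1 : (F.induce Sᶜ).Colorable k := (hG.of_hom f.toHom).of_hom e.symm.toHom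
  exact absurd (colorable_succ_of_induce_compl hS h1).chromaticNumber_le (not_le.2 hF)

lemma turanGraph_colorable (m : ℕ) {k : ℕ} (hk : 0 < k) :
    (SimpleGraph.turanGraph m k).Colorable k :=
  ⟨SimpleGraph.Coloring.mk (fun v => ⟨v % k, Nat.mod_lt _ hk⟩) fun h h' =>
    h (congrArg Fin.val h')⟩

lemma pow_le_card_cliquesIn_turanGraph (m k : ℕ) :
    (m / k) ^ k ≤ #(cliquesIn (SimpleGraph.turanGraph m k) k univ) := by
  classical
  obtain rfl | hk := Nat.eq_zero_or_pos k
  · simp only [pow_zero]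
    exact card_pos.2 ⟨∅, mem_cliquesIn.2 ⟨subset_univ _, by simp⟩⟩
  have hlt : ∀ (f : Fin k → Fin (m / k)) i, (f i : ℕ) * k + i < m := by
    intro f i
    have h1 : (f i : ℕ) + 1 ≤ m / k := (f i).2
    have h2 := Nat.mul_le_mul_right k h1
    have h3 := Nat.div_mul_le_self m k
    have h4 := i.2
    rw [Nat.add_mul] at h2
    omega
  -- The vertex of index `f i` in residue class `i`; remainder and quotient modulo `k` recover `i`
  -- and `f i`, so distinct `f` give distinct transversal cliques.
  let g : (Fin k → Fin (m / k)) → Fin k → Fin m := fun f i => ⟨f i * k + i, hlt f i⟩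
  have hmod : ∀ f i, (g f i : ℕ) % k = i := by
    intro f i
    simp only [g]
    rw [mul_comm, Nat.mul_add_mod, Nat.mod_eq_of_lt i.2]
  have hdiv : ∀ f i, (g f i : ℕ) / k = f i := by
    intro f i
    simp only [g]
    rw [mul_comm, Nat.mul_add_div hk, Nat.div_eq_of_lt i.2, add_zero]
  have hinj : ∀ f, Function.Injective (g f) := fun f i j h =>
    Fin.ext (by rw [← hmod f i, ← hmod f j, h])
  have hcard : #(univ : Finset (Fin k → Fin (m / k))) = (m / k) ^ k := by simp
  rw [← hcard]
  refine card_le_card_of_injOn (fun f => univ.image (g f)) ?_ ?_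
  · intro f _
    refine mem_cliquesIn.2 ⟨subset_univ _, (SimpleGraph.isNClique_iff _).2 ⟨?_, ?_⟩⟩
    · intro x hx y hy hxy
      obtain ⟨i, -, rfl⟩ := mem_image.1 (mem_coe.1 hx)
      obtain ⟨j, -, rfl⟩ := mem_image.1 (mem_coe.1 hy)
      rw [SimpleGraph.turanGraph_adj, hmod, hmod]
      exact fun h => hxy (by rw [Fin.ext h])
    · rw [card_image_of_injective _ (hinj f), card_univ, Fintype.card_fin]
  · intro f _ f' _ h
    funext i
    have hi : g f i ∈ univ.image (g f') :=
      (Finset.ext_iff.1 h _).1 (mem_image_of_mem _ (mem_univ i))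
    obtain ⟨j, -, hj⟩ := mem_image.1 hi
    have hji : j = i := Fin.ext (by rw [← hmod f' j, hj, hmod])
    subst hji
    exact Fin.ext (by rw [← hdiv f, ← hdiv f', hj])

lemma exists_mem_EX_deletionFamily {F : SimpleGraph V} {k : ℕ} (hk : 0 < k) (hF : ((k + 1 : ℕ) : ℕ∞) < F.chromaticNumber)
    (H : SimpleGraph W) (m : ℕ) : (EX m H (deletionFamily F)).Nonempty :=
  exists_mem_EX H (familyFree_deletionFamily_of_colorable hF (turanGraph_colorable m hk))

lemma pow_le_ex_deletionFamily {F : SimpleGraph V} {k : ℕ} (hk : 0 < k) (hF : ((k + 1 : ℕ) : ℕ∞) < F.chromaticNumber)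
    (m : ℕ) : (m / k) ^ k ≤ ex m (K k) (deletionFamily F) := by
  refine (pow_le_card_cliquesIn_turanGraph m k).trans ?_
  rw [← copyCount_K]
  exact copyCount_le_ex _ (familyFree_deletionFamily_of_colorable hF (turanGraph_colorable m hk))

end Turan

/-! ### Adding a vertex joined to a clique. -/

section Extend

variable {V : Type*}

/-- `G` together with a new vertex `none` joined to the vertices in `Q`. -/
def addVertex (G : SimpleGraph V) (Q : Finset V) : SimpleGraph (Option V) where
  Adj x y :=
    match x, y with
    | some v, some w => G.Adj v w
    | none, some w => w ∈ Q
    | some v, none => v ∈ Q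
    | none, none => False
  symm := ⟨by
    rintro (_ | v) (_ | w) h
    · exact h
    · exact h
    · exact h
    · exact G.adj_symm h⟩
  loopless := ⟨by
    rintro (_ | v) h
    · exact h
    · exact G.irrefl h⟩

/-- In a copy of `A` that uses the new vertex, that vertex can be exchanged for a vertex of `T` not
in the copy, which has at least the same neighbours `Q`. -/
lemma isContained_of_isContained_addVertex {W : Type*} [Fintype W] {A : SimpleGraph W}
    {G : SimpleGraph V} {Q T : Finset V} (hT : Fintype.card W < #T)
    (hTQ : ∀ t ∈ T, ∀ q ∈ Q, G.Adj t q) (h : A.IsContained (addVertex G Q)) :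
    A.IsContained G := by
  classical
  obtain ⟨φ⟩ := h
  -- The default of `getD` is an arbitrary element of `T`; it only makes the image a set of
  -- vertices, of size at most `|W| < |T|`.
  obtain ⟨t, htT, ht⟩ : ∃ t ∈ T, t ∉ univ.image
      fun a => (φ a).getD (T.card_pos.1 (by omega)).choose := by
    by_contra! h
    have := (card_le_card h).trans card_image_le
    rw [card_univ] at this
    omega
  have ht : ∀ a, φ a ≠ some t := by
    intro a ha
    exact ht (mem_image.2 ⟨a, mem_univ a, by rw [ha]; rfl⟩)
  refine ⟨⟨⟨fun a => (φ a).getD t, ?_⟩, ?_⟩⟩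
  · intro a b hab
    have h := φ.toHom.map_adj hab
    change (addVertex G Q).Adj (φ a) (φ b) at h
    cases ha : φ a <;> cases hb : φ b <;> rw [ha, hb] at h
    · exact h.elim
    · exact hTQ t htT _ h
    · exact (hTQ t htT _ h).symm
    · exact h
  · intro a b hab
    refine φ.injective (?_ : φ a = φ b)
    change (φ a).getD t = (φ b).getD t at hab
    have hta := ht a
    have htb := ht b
    cases ha : φ a <;> cases hb : φ b <;> rw [ha, hb] at hab <;> simp_all

lemma card_cliquesIn_lt_addVertex [Fintype V] {G : SimpleGraph V} {k : ℕ} {Q : Finset V}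
    (hQ : G.IsNClique k Q) :
    #(cliquesIn G (k + 1) univ) < #(cliquesIn (addVertex G Q) (k + 1) univ) := by
  classical
  have hnone : (none : Option V) ∉ univ.map Function.Embedding.some := by simp
  have hnew : insert none (Q.map .some) ∈ cliquesIn (addVertex G Q) (k + 1) univ := by
    refine mem_cliquesIn.2 ⟨subset_univ _, SimpleGraph.IsNClique.insert
      ((SimpleGraph.isNClique_iff _).2 ⟨?_, by simpa using hQ.card_eq⟩) ?_⟩
    · intro x hx y hy hxy
      obtain ⟨v, hv, rfl⟩ := mem_map.1 (mem_coe.1 hx)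
      obtain ⟨w, hw, rfl⟩ := mem_map.1 (mem_coe.1 hy)
      exact hQ.isClique hv hw fun h => hxy (by rw [h])
    · intro x hx
      obtain ⟨v, hv, rfl⟩ := mem_map.1 hx
      exact hv
  refine (card_cliquesIn_le_of_embedding (H := addVertex G Q)
    (C := univ.map Function.Embedding.some)
    Function.Embedding.some (fun v _ => mem_map_of_mem _ (mem_univ v))
    (fun v _ w _ h => h) (k + 1)).trans_lt (card_lt_card ?_)
  refine ⟨fun t ht => mem_cliquesIn.2 ⟨subset_univ _, (mem_cliquesIn.1 ht).2⟩, fun h => hnone ?_⟩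
  exact (mem_cliquesIn.1 (h hnew)).1 (mem_insert_self _ _)

/-- The common neighbours of the vertices in `Q`. -/
noncomputable def commonNbrs [Fintype V] (G : SimpleGraph V) (Q : Finset V) : Finset V := by
  classical exact {v | ∀ q ∈ Q, G.Adj v q}

lemma mem_commonNbrs [Fintype V] {G : SimpleGraph V} {Q : Finset V} {v : V} :
    v ∈ commonNbrs G Q ↔ ∀ q ∈ Q, G.Adj v q := by
  simp [commonNbrs]

/-- Each `(k+1)`-clique is a `k`-clique with one of its common neighbours, and there are at most
`|V|^k` choices of the `k`-clique. -/
lemma exists_clique_lt_card_commonNbrs [Fintype V] {G : SimpleGraph V} {k f : ℕ}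
    (h : f * Fintype.card V ^ k < #(cliquesIn G (k + 1) univ)) :
    ∃ Q, G.IsNClique k Q ∧ f < #(commonNbrs G Q) := by
  classical
  by_contra! hf
  refine h.not_ge ?_
  have hsub : cliquesIn G (k + 1) univ ⊆
      (cliquesIn G k univ).biUnion fun Q => (commonNbrs G Q).image fun v => insert v Q := by
    intro t ht
    obtain ⟨-, ht⟩ := mem_cliquesIn.1 ht
    obtain ⟨v, hv⟩ : t.Nonempty := by
      rw [← card_pos, ht.card_eq]
      omega
    refine mem_biUnion.2 ⟨t.erase v, mem_cliquesIn.2 ⟨subset_univ _, by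
      simpa using ht.erase_of_mem hv⟩, mem_image.2 ⟨v, mem_commonNbrs.2 fun w hw => ?_,
      insert_erase hv⟩⟩
    rw [mem_erase] at hw
    exact ht.isClique hv hw.2 hw.1.symm
  refine (card_le_card hsub).trans (card_biUnion_le.trans ?_)
  refine (sum_le_card_nsmul _ _ f fun Q hQ =>
    card_image_le.trans (hf Q (mem_cliquesIn.1 hQ).2)).trans ?_
  rw [smul_eq_mul, mul_comm]
  refine Nat.mul_le_mul_left f ?_
  have : cliquesIn G k univ ⊆ univ.powersetCard k := fun t ht =>
    mem_powersetCard.2 ⟨subset_univ _, (mem_cliquesIn.1 ht).2.card_eq⟩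
  refine (card_le_card this).trans ?_
  rw [card_powersetCard, card_univ]
  exact Nat.choose_le_pow _ _

end Extend

/-! ### Strict growth of `ex m (K (k + 1)) (deletionFamily F)`. -/

section Monotone

variable {V : Type*} [Fintype V] {F : SimpleGraph V} {k : ℕ}

lemma card_le_of_mem_deletionFamily {A : FinGraph} (hA : A ∈ deletionFamily F) :
    A.1 ≤ Fintype.card V := by
  obtain ⟨S, -, ⟨e⟩⟩ := hA
  simpa using Fintype.card_le_of_injective _ (Subtype.val_injective.comp e.injective)

/-- With `q = m / (k + 1) ≥ 1`, rounding costs at most a factor 2: `m ≤ 2(k + 1)q`. The threshold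
says `q > f(2(k + 1))^k`. -/
lemma mul_pow_lt_div_pow (f k : ℕ) {m : ℕ}
    (hm : (k + 1) * (f * (2 * (k + 1)) ^ k + 1) ≤ m) : f * m ^ k < (m / (k + 1)) ^ (k + 1) := by
  set q := m / (k + 1) with hq
  have h1 : f * (2 * (k + 1)) ^ k + 1 ≤ q := by
    rw [hq, Nat.le_div_iff_mul_le (by omega), mul_comm]
    exact hm
  have h2 : m ≤ 2 * (k + 1) * q := by
    have h3 : m < (k + 1) * (q + 1) := by
      rw [mul_comm]
      exact Nat.lt_mul_of_div_lt (Nat.lt_succ_self _) (by omega)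
    have h4 : (k + 1) * 1 ≤ (k + 1) * q := Nat.mul_le_mul_left _ (by omega)
    linarith
  calc f * m ^ k ≤ f * (2 * (k + 1) * q) ^ k := by gcongr
    _ = f * (2 * (k + 1)) ^ k * q ^ k := by rw [mul_pow, mul_assoc]
    _ < q * q ^ k := by
        refine Nat.mul_lt_mul_of_pos_right (by omega) (pow_pos (by omega) _)
    _ = q ^ (k + 1) := by rw [pow_succ, mul_comm]

lemma ex_deletionFamily_lt_succ (hF : ((k + 2 : ℕ) : ℕ∞) < F.chromaticNumber) {m : ℕ}
    (hm : (k + 1) * (Fintype.card V * (2 * (k + 1)) ^ k + 1) ≤ m) :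
    ex m (K (k + 1)) (deletionFamily F) < ex (m + 1) (K (k + 1)) (deletionFamily F) := by
  obtain ⟨G, hG, hGc⟩ := exists_mem_EX_deletionFamily (k := k + 1) (by omega) hF (K (k + 1)) m
  obtain ⟨Q, hQ, hcard⟩ : ∃ Q, G.IsNClique k Q ∧ Fintype.card V < #(commonNbrs G Q) := by
    refine exists_clique_lt_card_commonNbrs ?_
    rw [← copyCount_K, hGc, Fintype.card_fin]
    exact (mul_pow_lt_div_pow _ k hm).trans_le (pow_le_ex_deletionFamily (by omega) hF m)
  have hfree : FamilyFree (deletionFamily F) (addVertex G Q) := by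
    intro A hA hAG
    refine hG A hA (isContained_of_isContained_addVertex (T := commonNbrs G Q) ?_
      (fun t ht => mem_commonNbrs.1 ht) hAG)
    rw [Fintype.card_fin]
    exact (card_le_of_mem_deletionFamily hA).trans_lt hcard
  rw [← hGc, copyCount_K]
  refine (card_cliquesIn_lt_addVertex hQ).trans_le ?_
  simpa using card_cliquesIn_univ_le_ex hfree (k + 1)

lemma exists_forall_ex_deletionFamily_lt (hF : ((k + 2 : ℕ) : ℕ∞) < F.chromaticNumber) :
    ∃ s₀, ∀ s, s₀ ≤ s → ∀ m, m < s →
      ex m (K (k + 1)) (deletionFamily F) < ex s (K (k + 1)) (deletionFamily F) := by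
  set e : ℕ → ℕ := fun m => ex m (K (k + 1)) (deletionFamily F)
  set m₀ := (k + 1) * (Fintype.card V * (2 * (k + 1)) ^ k + 1)
  have hstep : ∀ m, m₀ ≤ m → e m < e (m + 1) := fun m hm => ex_deletionFamily_lt_succ hF hm
  have hadd : ∀ m, m₀ ≤ m → ∀ d, e m + d ≤ e (m + d) := by
    intro m hm d
    induction d with
    | zero => simp
    | succ d ih =>
      have := hstep (m + d) (by omega)
      rw [← add_assoc, ← add_assoc]
      omega
  -- Nothing is known about `e` below `m₀`, but from there on it grows by at least 1 per step; the
  -- extra steps carry it past every earlier value.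
  refine ⟨m₀ + (range m₀).sup e + 1, fun s hs m hm => ?_⟩
  change e m < e s
  obtain h | h := lt_or_ge m m₀
  · have h1 : e m ≤ (range m₀).sup e := le_sup (mem_range.2 h)
    have h2 := hadd m₀ le_rfl (s - m₀)
    rw [Nat.add_sub_cancel' (by omega)] at h2
    omega
  · have h2 := hadd m h (s - m)
    rw [Nat.add_sub_cancel' hm.le] at h2
    omega

end Monotone


/-! ### Matchings, covers and vertices of large degree. -/

section Matching

variable {V : Type*}

/-- `P` is a set of pairwise disjoint edges of `G`, each given as a pair of vertices. -/
structure IsPairMatching (G : SimpleGraph V) (P : Finset (V × V)) : Prop where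
  adj : ∀ p ∈ P, G.Adj p.1 p.2
  fst_ne_fst : ∀ p ∈ P, ∀ q ∈ P, p ≠ q → p.1 ≠ q.1
  fst_ne_snd : ∀ p ∈ P, ∀ q ∈ P, p ≠ q → p.1 ≠ q.2
  snd_ne_snd : ∀ p ∈ P, ∀ q ∈ P, p ≠ q → p.2 ≠ q.2

lemma IsPairMatching.subset {G : SimpleGraph V} {P Q : Finset (V × V)} (h : IsPairMatching G Q)
    (hPQ : P ⊆ Q) : IsPairMatching G P where
  adj p hp := h.adj p (hPQ hp)
  fst_ne_fst p hp q hq := h.fst_ne_fst p (hPQ hp) q (hPQ hq)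
  fst_ne_snd p hp q hq := h.fst_ne_snd p (hPQ hp) q (hPQ hq)
  snd_ne_snd p hp q hq := h.snd_ne_snd p (hPQ hp) q (hPQ hq)

lemma IsPairMatching.isContained {G : SimpleGraph V} {P : Finset (V × V)}
    (h : IsPairMatching G P) : (M #P).IsContained G := by
  let e := P.equivFin.symm
  let g : Fin #P × Bool → V := fun x => bif x.2 then (e x.1).1.2 else (e x.1).1.1
  have hne : ∀ {i j}, i ≠ j → (e i).1 ≠ (e j).1 := fun hij h' =>
    hij (e.injective (Subtype.ext h'))
  refine ⟨⟨⟨g, ?_⟩, ?_⟩⟩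
  · rintro ⟨i, a⟩ ⟨j, b⟩ ⟨h1, h2⟩
    obtain rfl : i = j := h1
    have := h.adj _ (e i).2
    cases a <;> cases b
    · exact absurd rfl h2
    · exact this
    · exact this.symm
    · exact absurd rfl h2
  · rintro ⟨i, a⟩ ⟨j, b⟩ hij
    change g (i, a) = g (j, b) at hij
    by_cases hi : i = j
    · subst hi
      have := (h.adj _ (e i).2).ne
      cases a <;> cases b
      · rfl
      · exact absurd hij this
      · exact absurd hij.symm this
      · rfl
    · exfalso
      cases a <;> cases b
      · exact h.fst_ne_fst _ (e i).2 _ (e j).2 (hne hi) hij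
      · exact h.fst_ne_snd _ (e i).2 _ (e j).2 (hne hi) hij
      · exact h.fst_ne_snd _ (e j).2 _ (e i).2 (hne (Ne.symm hi)) hij.symm
      · exact h.snd_ne_snd _ (e i).2 _ (e j).2 (hne hi) hij

lemma IsPairMatching.card_lt {G : SimpleGraph V} {P : Finset (V × V)}
    (h : IsPairMatching G P) {k : ℕ} (hG : (M k).Free G) : #P < k := by
  by_contra! hk
  obtain ⟨Q, hQP, hQ⟩ := exists_subset_card_eq hk
  exact hG (hQ ▸ (h.subset hQP).isContained)

/-- A graph without a matching of `s + 1` edges has a vertex cover of size at most `2 * s`. -/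
lemma exists_cover_of_free [Fintype V] {G : SimpleGraph V} {s : ℕ} (hG : (M (s + 1)).Free G) :
    ∃ U : Finset V, #U ≤ 2 * s ∧ ∀ v w, G.Adj v w → v ∈ U ∨ w ∈ U := by
  classical
  obtain ⟨P, hP, hmax⟩ := exists_max_image (univ.filter fun P => IsPairMatching G P) card
    ⟨∅, by simpa using ⟨by simp, by simp, by simp, by simp⟩⟩
  replace hP : IsPairMatching G P := by simpa using hP
  have hs := hP.card_lt hG
  -- The endpoints of a maximum matching: an edge missing all of them could be added to it.
  refine ⟨P.image Prod.fst ∪ P.image Prod.snd, ?_, ?_⟩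
  · refine (card_union_le _ _).trans ?_
    have h1 := card_image_le (s := P) (f := Prod.fst)
    have h2 := card_image_le (s := P) (f := Prod.snd)
    omega
  · intro v w hvw
    by_contra! h
    obtain ⟨hv, hw⟩ := h
    have hv1 : ∀ p ∈ P, p.1 ≠ v := fun p hp h => hv (mem_union_left _ (h ▸ mem_image_of_mem _ hp))
    have hv2 : ∀ p ∈ P, p.2 ≠ v := fun p hp h => hv (mem_union_right _ (h ▸ mem_image_of_mem _ hp))
    have hw1 : ∀ p ∈ P, p.1 ≠ w := fun p hp h => hw (mem_union_left _ (h ▸ mem_image_of_mem _ hp))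
    have hw2 : ∀ p ∈ P, p.2 ≠ w := fun p hp h => hw (mem_union_right _ (h ▸ mem_image_of_mem _ hp))
    have hnot : (v, w) ∉ P := fun h => hv1 _ h rfl
    have hins : IsPairMatching G (insert (v, w) P) := by
      refine ⟨?_, ?_, ?_, ?_⟩
      · intro p hp
        obtain rfl | hp := mem_insert.1 hp
        · exact hvw
        · exact hP.adj p hp
      all_goals
        intro p hp q hq hpq
        obtain rfl | hp := mem_insert.1 hp <;> obtain rfl | hq := mem_insert.1 hq
      · exact absurd rfl hpq
      · exact (hv1 q hq).symm
      · exact hv1 p hp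
      · exact hP.fst_ne_fst p hp q hq hpq
      · exact absurd rfl hpq
      · exact (hv2 q hq).symm
      · exact hw1 p hp
      · exact hP.fst_ne_snd p hp q hq hpq
      · exact absurd rfl hpq
      · exact (hw2 q hq).symm
      · exact hw2 p hp
      · exact hP.snd_ne_snd p hp q hq hpq
    have := hmax _ (mem_filter.2 ⟨mem_univ _, hins⟩)
    rw [card_insert_of_notMem hnot] at this
    omega

lemma isPairMatching_image [DecidableEq V] {G : SimpleGraph V} {A : Finset V} {g : A → V}
    (hg : Function.Injective g) (hadj : ∀ a : A, G.Adj a (g a)) (hA : ∀ a, g a ∉ A) :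
    IsPairMatching G (univ.image fun a : A => ((a : V), g a)) := by
  have key : ∀ p ∈ univ.image fun a : A => ((a : V), g a), ∃ a : A, p = ((a : V), g a) := by
    intro p hp
    obtain ⟨a, -, rfl⟩ := mem_image.1 hp
    exact ⟨a, rfl⟩
  refine ⟨?_, ?_, ?_, ?_⟩
  · intro p hp
    obtain ⟨a, rfl⟩ := key p hp
    exact hadj a
  all_goals
    intro p hp q hq hpq h
    obtain ⟨a, rfl⟩ := key p hp
    obtain ⟨b, rfl⟩ := key q hq
  · exact hpq (by rw [Subtype.ext h])
  · exact hA b (by rw [← show (a : V) = g b from h]; exact a.2)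
  · exact hpq (by rw [hg h])

lemma card_image_pair [DecidableEq V] {A : Finset V} (g : A → V) :
    #(univ.image fun a : A => ((a : V), g a)) = #A := by
  rw [card_image_of_injective _ fun a b h => Subtype.ext (congrArg Prod.fst h), card_univ,
    Fintype.card_coe]

/-- Vertices of large degree can be matched into the complement of a small set. -/
lemma exists_injective_adj_notMem [Fintype V] {G : SimpleGraph V} {A X : Finset V}
    (h : ∀ a ∈ A, #A + #X ≤ #(nbrs G a)) :
    ∃ g : A → V, Function.Injective g ∧ ∀ a : A, G.Adj a (g a) ∧ g a ∉ X := by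
  classical
  obtain ⟨g, hg, hmem⟩ := (Finset.all_card_le_biUnion_card_iff_exists_injective
    (fun a : A => nbrs G a \ X)).1 (by
      intro S
      -- Hall's condition: a single set `nbrs G a \ X` already has at least `|A|` elements.
      obtain rfl | ⟨a, ha⟩ := S.eq_empty_or_nonempty
      · simp
      have h1 : #S ≤ #A := by simpa using card_le_univ S
      have h2 := h a a.2
      have h3 := le_card_sdiff X (nbrs G a)
      have h4 := card_le_card (subset_biUnion_of_mem (fun a : A => nbrs G a \ X) ha)
      omega)
  exact ⟨g, hg, fun a => by simpa using hmem a⟩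

/-- Otherwise `s + 1` such vertices could be matched into their complement; this requires degree `(s
+ 1) + (s + 1)`. -/
lemma card_le_of_free_of_large_degree [Fintype V] {G : SimpleGraph V} {s : ℕ}
    (hG : (M (s + 1)).Free G) {A : Finset V} (hA : ∀ a ∈ A, 2 * s + 2 ≤ #(nbrs G a)) :
    #A ≤ s := by
  classical
  by_contra! h
  obtain ⟨B, hBA, hB⟩ := exists_subset_card_eq (Nat.succ_le_of_lt h)
  obtain ⟨g, hg, hadj⟩ := exists_injective_adj_notMem (G := G) (A := B) (X := B) fun a ha => by
    have := hA a (hBA ha)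
    omega
  have := (isPairMatching_image hg (fun a => (hadj a).1) fun a => (hadj a).2).card_lt hG
  rw [card_image_pair] at this
  omega

/-- Matching `A` outside `A ∪ {u, v}` requires degree `s + (s + 2)`; with the edge `uv` this would
give `s + 1` disjoint edges. -/
lemma not_adj_of_free_of_large_degree [Fintype V] {G : SimpleGraph V} {s : ℕ}
    (hG : (M (s + 1)).Free G) {A : Finset V} (hA : ∀ a ∈ A, 2 * s + 2 ≤ #(nbrs G a))
    (hAs : #A = s) {u v : V} (hu : u ∉ A) (hv : v ∉ A) : ¬ G.Adj u v := by
  classical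
  intro huv
  have hcard : #(insert u (insert v A)) ≤ s + 2 :=
    (card_insert_le _ _).trans (Nat.add_le_add_right ((card_insert_le _ _).trans (by omega)) 1)
  obtain ⟨g, hg, hadj⟩ := exists_injective_adj_notMem (G := G) (A := A)
    (X := insert u (insert v A)) fun a ha => by
      have := hA a ha
      omega
  have hgu : ∀ a, g a ≠ u := fun a h => (hadj a).2 (by simp [h])
  have hgv : ∀ a, g a ≠ v := fun a h => (hadj a).2 (by simp [h])
  have hgA : ∀ a, g a ∉ A := fun a h => (hadj a).2 (by simp [h])
  -- The edge `uv` is treated as one more matched pair, with `u` on the side of `A`.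
  let g' : (↥(insert u A)) → V := fun a =>
    if ha : (a : V) ∈ A then g ⟨a, ha⟩ else v
  have hu' : ∀ a : ↥(insert u A), (a : V) ∉ A → (a : V) = u := fun a ha =>
    (mem_insert.1 a.2).resolve_right ha
  have := (isPairMatching_image (G := G) (g := g') ?_ ?_ ?_).card_lt hG
  · rw [card_image_pair, card_insert_of_notMem hu] at this
    omega
  · intro a b hab
    by_cases ha : (a : V) ∈ A <;> by_cases hb : (b : V) ∈ A <;>
      simp only [g', ha, hb, dite_true, dite_false] at hab
    · exact Subtype.ext (congrArg Subtype.val (hg hab) :)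
    · exact absurd hab (hgv _)
    · exact absurd hab.symm (hgv _)
    · exact Subtype.ext ((hu' a ha).trans (hu' b hb).symm)
  · intro a
    by_cases ha : (a : V) ∈ A <;> simp only [g', ha, dite_true, dite_false]
    · exact (hadj ⟨a, ha⟩).1
    · rw [hu' a ha]
      exact huv
  · intro a
    by_cases ha : (a : V) ∈ A <;> simp only [g', ha, dite_true, dite_false, mem_insert, not_or]
    · exact ⟨hgu _, hgA _⟩
    · exact ⟨huv.ne', hv⟩

end Matching

/-! ### Embeddings into joins, and the lower-bound construction. -/

section Join

variable {V W : Type*}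

/-- If enough vertices outside `B` are joined to all of `B`, and `G` does not contain `F`, then
`G[B]` contains no graph obtained from `F` by deleting an independent set. -/
lemma familyFree_induce_deletionFamily [Fintype W] {F : SimpleGraph W} {G : SimpleGraph V}
    (hG : F.Free G) {B T : Finset V} (hT : Fintype.card W ≤ #T)
    (hTB : ∀ t ∈ T, ∀ b ∈ B, G.Adj t b) :
    FamilyFree (deletionFamily F) (G.induce (B : Set V)) := by
  classical
  rintro A ⟨S, hS, ⟨e⟩⟩ ⟨f⟩
  refine hG ?_
  obtain ⟨g⟩ : Nonempty (W ↪ T) := Function.Embedding.nonempty_of_card_le (by simpa using hT)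
  -- The independent set `S` goes into `T`, where no edges are needed; the rest of `F` follows its
  -- copy in `B`.
  let h : W → V := fun w => if hw : w ∈ S then g w else f (e.symm ⟨w, hw⟩)
  have hadj : ∀ w w', w ∈ S → w' ∉ S → G.Adj (h w) (h w') := by
    intro w w' hw hw'
    simp only [h, hw, hw', dite_true, dite_false]
    exact hTB _ (g w).2 _ (f (e.symm ⟨w', hw'⟩)).2
  refine ⟨⟨⟨h, ?_⟩, ?_⟩⟩
  · intro w w' hww
    by_cases hw : w ∈ S <;> by_cases hw' : w' ∈ S
    · exact absurd hww (hS hw hw' hww.ne)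
    · exact hadj w w' hw hw'
    · exact (hadj w' w hw' hw).symm
    · simp only [h, hw, hw', dite_false]
      exact f.toHom.map_adj (e.symm.map_rel_iff.2 (show (F.induce Sᶜ).Adj ⟨w, hw⟩ ⟨w', hw'⟩ from hww))
  · intro w w' hww
    change h w = h w' at hww
    by_cases hw : w ∈ S <;> by_cases hw' : w' ∈ S
    · simp only [h, hw, hw', dite_true] at hww
      exact g.injective (Subtype.ext hww)
    · exact absurd hww (hadj w w' hw hw').ne
    · exact absurd hww.symm (hadj w' w hw' hw).ne
    · simp only [h, hw, hw', dite_false] at hww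
      have := e.symm.injective (f.injective (Subtype.ext hww))
      exact congrArg Subtype.val this

/-- In a copy of `F`, the vertices landing in `I m` are independent; deleting them would leave a
member of `𝓓(F)` inside `D`. -/
lemma free_join_I {F : SimpleGraph W} {D : SimpleGraph V}
    (hD : FamilyFree (deletionFamily F) D) (m : ℕ) [Finite W] : F.Free (join D (I m)) := by
  classical
  rintro ⟨f⟩
  let S : Set W := {w | (f w).isRight}
  have hS : F.IsIndepSet S := by
    intro v hv w hw _ hvw
    have h := f.toHom.map_adj hvw
    change (join D (I m)).Adj (f v) (f w) at h
    simp only [S, Set.mem_ofPred_eq] at hv hw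
    cases hfv : f v <;> cases hfw : f w <;> simp [hfv, hfw] at hv hw
    rw [hfv, hfw] at h
    exact h
  obtain ⟨n, ⟨e⟩⟩ := Finite.exists_equiv_fin (Sᶜ : Set W)
  refine hD ⟨n, (F.induce Sᶜ).comap e.symm⟩
    ⟨S, hS, ⟨SimpleGraph.Iso.comap e.symm (F.induce Sᶜ)⟩⟩ ?_
  refine SimpleGraph.IsContained.trans ⟨(SimpleGraph.Iso.comap e.symm (F.induce Sᶜ)).toCopy⟩ ?_
  have hl : ∀ w : (Sᶜ : Set W), ∃ d, f w = Sum.inl d := by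
    rintro ⟨w, hw⟩
    cases h : f w with
    | inl d => exact ⟨d, rfl⟩
    | inr d => exact absurd (by simp [S, h]) hw
  choose g hg using hl
  refine ⟨⟨⟨g, ?_⟩, ?_⟩⟩
  · intro a b hab
    have h := f.toHom.map_adj (show F.Adj a b from hab)
    change (join D (I m)).Adj (f a) (f b) at h
    rw [hg, hg] at h
    exact h
  · intro a b hab
    change g a = g b at hab
    have h : f a = f b := by rw [hg, hg, hab]
    exact Subtype.ext (f.injective h)

/-- Every edge of the join has an end among the `s` vertices of `D`. -/
lemma matching_free_join_I (s m : ℕ) (D : SimpleGraph (Fin s)) :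
    (M (s + 1)).Free (join D (I m)) := by
  classical
  rintro ⟨f⟩
  have hl : ∀ i : Fin (s + 1), ∃ (b : Bool) (d : Fin s), f (i, b) = Sum.inl d := by
    intro i
    have h : (join D (I m)).Adj (f (i, false)) (f (i, true)) :=
      f.toHom.map_adj (show (M (s + 1)).Adj (i, false) (i, true) from ⟨rfl, by simp⟩)
    cases h1 : f (i, false) with
    | inl d => exact ⟨false, d, h1⟩
    | inr d =>
      cases h2 : f (i, true) with
      | inl d => exact ⟨true, d, h2⟩
      | inr d' =>
        rw [h1, h2] at h
        exact h.elim
  choose b d hd using hl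
  have hinj : Function.Injective d := by
    intro i j hij
    have : f (i, b i) = f (j, b j) := by rw [hd, hd, hij]
    exact congrArg Prod.fst (f.injective this)
  simpa using Fintype.card_le_of_injective d hinj

lemma forall_mem_isoClass_free_iff [Finite W] {H : SimpleGraph W} {G : SimpleGraph V} :
    (∀ A ∈ isoClass H, A.2.Free G) ↔ H.Free G := by
  refine ⟨fun h hH => ?_, fun h A ⟨e⟩ hA => h (SimpleGraph.IsContained.trans ⟨e.symm.toCopy⟩ hA)⟩
  obtain ⟨n, ⟨e⟩⟩ := Finite.exists_equiv_fin W
  exact h ⟨n, H.comap e.symm⟩ ⟨SimpleGraph.Iso.comap e.symm H⟩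
    (SimpleGraph.IsContained.trans ⟨(SimpleGraph.Iso.comap e.symm H).toCopy⟩ hH)

lemma familyFree_forbiddenPair_iff [Finite W] {F : SimpleGraph W} {s : ℕ} {G : SimpleGraph V} :
    FamilyFree (forbiddenPair F s) G ↔ F.Free G ∧ (M (s + 1)).Free G := by
  rw [← forall_mem_isoClass_free_iff, ← forall_mem_isoClass_free_iff (H := M (s + 1))]
  simp only [FamilyFree, forbiddenPair, Set.mem_union, or_imp, forall_and]

/-- This direction suffices, since the upper bound for arbitrary `G` is stated with the same
left-hand side. -/
lemma add_mul_le_copyCount_join_I [Fintype V] (D : SimpleGraph V) (m k : ℕ) :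
    #(cliquesIn D (k + 1) univ) + m * #(cliquesIn D k univ) ≤
      (join D (I m)).copyCount (K (k + 1)) := by
  classical
  rw [copyCount_K]
  let L := (cliquesIn D (k + 1) univ).map ⟨_, map_injective (Function.Embedding.inl (β := Fin m))⟩
  let R := ((univ : Finset (Fin m)) ×ˢ cliquesIn D k univ).image
    fun p => (insert (Sum.inr p.1) (p.2.map .inl) : Finset (V ⊕ Fin m))
  have hclique : ∀ {j : ℕ} {t : Finset V}, D.IsNClique j t →
      (join D (I m)).IsNClique j (t.map Function.Embedding.inl) := by
    intro j t ht
    refine (SimpleGraph.isNClique_iff _).2 ⟨?_, by simpa using ht.card_eq⟩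
    intro x hx y hy hxy
    obtain ⟨v, hv, rfl⟩ := mem_map.1 (mem_coe.1 hx)
    obtain ⟨w, hw, rfl⟩ := mem_map.1 (mem_coe.1 hy)
    exact ht.isClique hv hw fun h => hxy (by rw [h])
  have hRcard : #R = m * #(cliquesIn D k univ) := by
    rw [card_image_of_injective, card_product, card_univ, Fintype.card_fin]
    rintro ⟨i, t⟩ ⟨j, u⟩ h
    have h' := Finset.ext_iff.1 h
    have h1 : i = j := by simpa using h' (Sum.inr i)
    have h2 : t = u := by
      ext v
      simpa using h' (Sum.inl v)
    rw [h1, h2]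
  have hdisj : Disjoint L R := by
    rw [disjoint_left]
    intro x hx hx'
    obtain ⟨t, -, rfl⟩ := mem_map.1 hx
    obtain ⟨p, -, hp⟩ := mem_image.1 hx'
    have := Finset.ext_iff.1 hp (Sum.inr p.1)
    simp at this
  have hLcard : #L = #(cliquesIn D (k + 1) univ) := card_map _
  rw [← hLcard, ← hRcard, ← card_union_of_disjoint hdisj]
  refine card_le_card (union_subset ?_ ?_)
  · intro x hx
    obtain ⟨t, ht, rfl⟩ := mem_map.1 hx
    exact mem_cliquesIn.2 ⟨subset_univ _, hclique (mem_cliquesIn.1 ht).2⟩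
  · intro x hx
    obtain ⟨p, hp, rfl⟩ := mem_image.1 hx
    refine mem_cliquesIn.2 ⟨subset_univ _,
      (hclique (mem_cliquesIn.1 (mem_product.1 hp).2).2).insert ?_⟩
    intro y hy
    obtain ⟨v, -, rfl⟩ := mem_map.1 hy
    trivial

end Join


/-! ### The upper bound and the conclusion. -/

section UpperBound

variable {V W : Type*} [Fintype V] [Fintype W]

open scoped Classical in
/-- The vertices of `G` of degree at least `d`. -/
noncomputable def largeDegree (G : SimpleGraph V) (d : ℕ) : Finset V :=
  {v | d ≤ #(nbrs G v)}

lemma mem_largeDegree {G : SimpleGraph V} {d : ℕ} {v : V} :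
    v ∈ largeDegree G d ↔ d ≤ #(nbrs G v) := by
  simp [largeDegree]

/-- In an `{F, M_{s+1}}`-free graph, all but boundedly many vertices have only neighbours of large
degree, and their neighbourhoods induce `𝓓(F)`-free graphs. -/
lemma exists_exceptional_set {F : SimpleGraph W} {G : SimpleGraph V} {s : ℕ} (hF : F.Free G)
    (hM : (M (s + 1)).Free G) :
    ∃ X : Finset V, #X ≤ 2 * s + 2 * s * (2 * s + 2) + 2 ^ s * Fintype.card W ∧
      ∀ v ∉ X, nbrs G v ⊆ largeDegree G (2 * s + 2) ∧
        FamilyFree (deletionFamily F) (G.induce (nbrs G v : Set V)) := by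
  classical
  obtain ⟨U, hU, hcover⟩ := exists_cover_of_free hM
  set A := largeDegree G (2 * s + 2)
  have hA : #A ≤ s := card_le_of_free_of_large_degree hM fun a ha => mem_largeDegree.1 ha
  -- A vertex outside `X₁` has all its neighbours in the cover `U`, and none of them has small
  -- degree.
  let X₁ := U ∪ (U \ A).biUnion (nbrs G)
  let T : Finset V → Finset V := fun B => X₁ᶜ.filter fun v => nbrs G v = B
  -- Vertices outside `X₁` are classed by neighbourhood, a subset of `A`; the at most `2^s` classes
  -- too small to host an independent set of `F` are discarded.
  let X₂ := A.powerset.biUnion fun B => if #(T B) < Fintype.card W then T B else ∅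
  refine ⟨X₁ ∪ X₂, ?_, ?_⟩
  · have h1 : #((U \ A).biUnion (nbrs G)) ≤ 2 * s * (2 * s + 2) := by
      refine (card_biUnion_le_card_mul _ _ (2 * s + 2) fun v hv => ?_).trans
        (Nat.mul_le_mul_right _ ((card_le_card sdiff_subset).trans hU))
      have := mt mem_largeDegree.2 (mem_sdiff.1 hv).2
      omega
    have h2 : #X₂ ≤ 2 ^ s * Fintype.card W := by
      refine (card_biUnion_le_card_mul _ _ (Fintype.card W) fun B _ => ?_).trans
        (Nat.mul_le_mul_right _ ?_)
      · split_ifs with h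
        · exact h.le
        · simp
      · rw [card_powerset]
        exact Nat.pow_le_pow_right (by omega) hA
    have h3 : #X₁ ≤ #U + #((U \ A).biUnion (nbrs G)) := card_union_le _ _
    have h4 := card_union_le X₁ X₂
    omega
  · intro v hv
    obtain ⟨hv₁, hv₂⟩ := not_or.1 (mt mem_union.2 hv)
    obtain ⟨hvU, hvn⟩ := not_or.1 (mt mem_union.2 hv₁)
    have hsub : nbrs G v ⊆ A := by
      intro w hw
      have hvw := mem_nbrs.1 hw
      by_contra hwA
      refine hvn (mem_biUnion.2 ⟨w, mem_sdiff.2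
        ⟨(hcover v w hvw).resolve_left hvU, hwA⟩, mem_nbrs.2 hvw.symm⟩)
    refine ⟨hsub, familyFree_induce_deletionFamily hF (T := T (nbrs G v)) ?_ ?_⟩
    · by_contra! h
      refine hv₂ (mem_biUnion.2 ⟨nbrs G v, mem_powerset.2 hsub, ?_⟩)
      rw [if_pos h]
      exact mem_filter.2 ⟨mem_compl.2 hv₁, rfl⟩
    · intro t ht b hb
      exact mem_nbrs.1 ((mem_filter.1 ht).2 ▸ hb)

lemma card_cliquesIn_le_of_isDF {F : SimpleGraph W} {s k : ℕ}
    (hlt : ∀ m, m < s → ex m (K k) (deletionFamily F) < ex s (K k) (deletionFamily F))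
    {D : SimpleGraph (Fin s)} (hD : IsDF F s (k + 1) D) {G : SimpleGraph V} (hF : F.Free G)
    (hM : (M (s + 1)).Free G)
    (hn : 2 ^ (2 * s + 2 * s * (2 * s + 2) + 2 ^ s * Fintype.card W) +
      s * ex s (K k) (deletionFamily F) ≤ Fintype.card V) :
    #(cliquesIn G (k + 1) univ) ≤
      #(cliquesIn D (k + 1) univ) + (Fintype.card V - s) * #(cliquesIn D k univ) := by
  classical
  obtain ⟨X, hX, hXv⟩ := exists_exceptional_set hF hM
  have hDk : #(cliquesIn D k univ) = ex s (K k) (deletionFamily F) := by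
    rw [← copyCount_K]
    exact hD.1.2
  rw [hDk]
  set N := Fintype.card V
  set A := largeDegree G (2 * s + 2)
  set e := ex s (K k) (deletionFamily F)
  have hA : #A ≤ s := card_le_of_free_of_large_degree hM fun a ha => mem_largeDegree.1 ha
  -- In the first case each vertex outside `X` loses at least one clique against `e`. The total loss
  -- outweighs the at most `2 ^ #X` cliques inside `X` and the term `s * e`, by `hn`.
  by_cases hcase : ∀ v ∉ X, #(cliquesIn G k (nbrs G v)) < e
  · have hsum : ∑ v ∈ Xᶜ, #(cliquesIn G k (nbrs G v)) ≤ N * (e - 1) := by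
      refine (sum_le_card_nsmul _ _ (e - 1) fun v hv => ?_).trans ?_
      · exact Nat.le_sub_one_of_lt (hcase v (mem_compl.1 hv))
      · exact Nat.mul_le_mul_right _ (card_le_univ _)
    have h1 := card_cliquesIn_le_add_sum G k X
    have h2 : #(cliquesIn G (k + 1) X) ≤ _ :=
      (card_cliquesIn_le_two_pow G (k + 1) X).trans (Nat.pow_le_pow_right (by omega) hX)
    -- A vertex outside `X` is needed to get `e ≥ 1`, so that `e - 1` is not truncated.
    have h3 : X ≠ univ := by
      intro h
      have h4 : #X = N := by rw [h, card_univ]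
      have h5 := Nat.lt_two_pow_self (n := 2 * s + 2 * s * (2 * s + 2) + 2 ^ s * Fintype.card W)
      omega
    obtain ⟨v, hv⟩ : ∃ v, v ∉ X := by
      by_contra! h
      exact h3 (eq_univ_of_forall h)
    have he : 1 ≤ e := Nat.one_le_of_lt (hcase v hv)
    have h6 : N * (e - 1) + N = N * e := by
      rw [← Nat.mul_succ]
      congr 1
      omega
    rw [Nat.sub_mul]
    omega
  · push Not at hcase
    obtain ⟨v, hvX, hv⟩ := hcase
    obtain ⟨hvA, hvfree⟩ := hXv v hvX
    have hle : e ≤ ex #(nbrs G v) (K k) (deletionFamily F) :=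
      hv.trans (card_cliquesIn_le_ex hvfree k)
    have hcard : #(nbrs G v) = s := by
      refine le_antisymm ((card_le_card hvA).trans hA) ?_
      by_contra! h
      exact (hlt _ h).not_ge hle
    have hAv : nbrs G v = A := eq_of_subset_of_card_le hvA (by omega)
    rw [hAv] at hv hvfree hcard
    obtain ⟨D', ⟨i⟩⟩ := exists_iso_induce G hcard
    have hD'free : FamilyFree (deletionFamily F) D' := hvfree.of_isContained i.isContained
    have hD'mem : D' ∈ EX s (K k) (deletionFamily F) := by
      refine ⟨hD'free, le_antisymm (copyCount_le_ex _ hD'free) ?_⟩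
      rw [copyCount_K, card_cliquesIn_induce i]
      exact hv
    have hAk : #(cliquesIn G k A) = e := by
      rw [← card_cliquesIn_induce i, ← copyCount_K]
      exact hD'mem.2
    -- `G[A]` is itself in `EX`, so the tie-breaking clause of `IsDF` applies to it.
    have hAk' : #(cliquesIn G (k + 1) A) ≤ #(cliquesIn D (k + 1) univ) := by
      rw [← card_cliquesIn_induce i, ← copyCount_K, ← copyCount_K]
      exact hD.2 D' hD'mem
    refine (card_cliquesIn_le_add_sum G k A).trans (Nat.add_le_add hAk' ?_)
    refine (sum_le_card_nsmul _ _ e fun w hw => ?_).trans ?_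
    -- As `|A| = s`, a vertex outside `A` has all its neighbours in `A`.
    · rw [← hAk]
      refine card_cliquesIn_mono (fun u hu => ?_) k
      by_contra huA
      exact not_adj_of_free_of_large_degree hM (fun a ha => mem_largeDegree.1 ha) hcard
        (mem_compl.1 hw) huA (mem_nbrs.1 hu)
    · rw [card_compl, hcard, smul_eq_mul]

lemma exists_isDF {U : Type*} {F : SimpleGraph U} {k : ℕ} (hk : 0 < k)
    (hF : ((k + 1 : ℕ) : ℕ∞) < F.chromaticNumber) (s : ℕ) :
    ∃ D : SimpleGraph (Fin s), IsDF F s (k + 1) D := by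
  obtain ⟨D, hD, hmax⟩ := Set.exists_max_image (EX s (K k) (deletionFamily F))
    (fun D => D.copyCount (K (k + 1))) (Set.toFinite _) (exists_mem_EX_deletionFamily hk hF _ s)
  exact ⟨D, hD, hmax⟩

lemma exists_iso_fin_of_card {n : ℕ} (G : SimpleGraph V) (h : Fintype.card V = n) :
    ∃ H : SimpleGraph (Fin n), Nonempty (H ≃g G) :=
  ⟨_, ⟨SimpleGraph.Iso.comap (Fintype.equivFinOfCardEq h).symm G⟩⟩

lemma ex_forbiddenPair_eq {F : SimpleGraph W} {s k n : ℕ}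
    (hlt : ∀ m, m < s → ex m (K k) (deletionFamily F) < ex s (K k) (deletionFamily F))
    {D : SimpleGraph (Fin s)} (hD : IsDF F s (k + 1) D) (hsn : s ≤ n)
    (hn : 2 ^ (2 * s + 2 * s * (2 * s + 2) + 2 ^ s * Fintype.card W) +
      s * ex s (K k) (deletionFamily F) ≤ n) :
    ex n (K (k + 1)) (forbiddenPair F s) = (join D (I (n - s))).copyCount (K (k + 1)) := by
  have hfree : FamilyFree (forbiddenPair F s) (join D (I (n - s))) :=
    familyFree_forbiddenPair_iff.2 ⟨free_join_I hD.1.1 _, matching_free_join_I s _ D⟩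
  have hcard : Fintype.card (Fin s ⊕ Fin (n - s)) = n := by simp [hsn]
  refine le_antisymm ?_ ?_
  · obtain ⟨H, ⟨i⟩⟩ := exists_iso_fin_of_card _ hcard
    obtain ⟨G, hG, hGc⟩ := exists_mem_EX (K (k + 1)) (hfree.of_isContained i.isContained)
    obtain ⟨hGF, hGM⟩ := familyFree_forbiddenPair_iff.1 hG
    rw [← hGc, copyCount_K]
    refine (card_cliquesIn_le_of_isDF hlt hD hGF hGM (by simpa using hn)).trans ?_
    rw [Fintype.card_fin]
    exact add_mul_le_copyCount_join_I D (n - s) k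
  · rw [copyCount_K]
    exact (card_cliquesIn_univ_le_ex hfree (k + 1)).trans_eq (by rw [hcard])

end UpperBound

end GenTuran

theorem theorem1p5 {V : Type*} [Finite V] (F : SimpleGraph V) (r : ℕ) (hr : 3 ≤ r)
    (hF : (r : ℕ∞) < F.chromaticNumber) :
    ∃ s₀ : ℕ, ∀ s : ℕ, s₀ ≤ s →
      (∃ D : SimpleGraph (Fin s), GenTuran.IsDF F s r D) ∧
      ∃ n₀ : ℕ, ∀ n : ℕ, n₀ ≤ n → s ≤ n →
        ∀ D : SimpleGraph (Fin s), GenTuran.IsDF F s r D →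
          GenTuran.ex n (GenTuran.K r) (GenTuran.forbiddenPair F s) =
            (GenTuran.join D (GenTuran.I (n - s))).copyCount (GenTuran.K r) := by
  have := Fintype.ofFinite V
  obtain ⟨k, rfl⟩ : ∃ k, r = k + 2 := ⟨r - 2, by omega⟩
  obtain ⟨s₀, hs₀⟩ := GenTuran.exists_forall_ex_deletionFamily_lt (F := F) (k := k) hF
  -- The witness `n₀` left as `_` is the threshold in the hypothesis `hn` of `ex_forbiddenPair_eq`,
  -- which does not depend on `D`.
  refine ⟨s₀, fun s hs => ⟨GenTuran.exists_isDF (k := k + 1) (by omega) hF s, _,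
    fun n hn hsn D hD => GenTuran.ex_forbiddenPair_eq (hs₀ s hs) hD hsn hn⟩⟩
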